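/- Let $a, b \ge 0$, $T_e < T_c$, $E \ge 0$ and $D > 0$ be real constants. Consider a transmitter that has the energy $E$ at time $0$ and harvests no further energy up to the deadline $D$. A feasible power policy is a nonnegative measurable function $P$ on $[0,D]$ that satisfies, for all $t \in [0,D]$, the energy constraint $\int_0^t P(\tau)\,d\tau \le E$ and the temperature constraint $$\int_0^t a e^{b\tau} P(\tau)\,d\tau \le (T_c - T_e)\, e^{bt} .$$ The temperature under $P$ is the (absolutely continuous) solution $T$ on $[0,D]$ of $$T'(t) = a P(t) - b\,(T(t) - T_e) \ \text{ for almost every } t, \qquad T(0) = T_e ,$$ so that the temperature constraint says that $T(t) \le T_c$ for all $t\in[0,D]$. A policy is optimal if it is feasible and maximizes the throughput $\int_0^D \tfrac12 \log_2(1 + P(\tau))\,d\tau$ among all feasible policies. Then the temperature $T$ under an optimal policy is a monotone increasing (that is, nondecreasing) and concave function of $t$ on $[0,D]$. -/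

import Mathlib

open MeasureTheory Set

namespace HeatedTransmitter

/-- The throughput `∫₀ᴰ (1/2) log₂ (1 + P(τ)) dτ` of the power policy `P` up to the deadline `D`. -/
noncomputable def throughput (D : ℝ) (P : ℝ → ℝ) : ℝ :=
  ∫ τ in (0 : ℝ)..D, (1 / 2) * Real.logb 2 (1 + P τ)

/-- Feasible power policies on `[0, D]` when an energy `E` is available at time `0` and nothing
arrives later: nonnegative (Lebesgue) measurable functions on `[0, D]` that satisfy the temperature
constraint (with initial temperature `Te`, critical temperature `Tc`) and the energy constraint.
Integrability contains measurability; beyond that it says that the energy spent is finite, as the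
energy constraint demands, so that no integral below takes a default value. -/
structure IsFeasible (a b Te Tc E D : ℝ) (P : ℝ → ℝ) : Prop where
  nonneg : ∀ t ∈ Icc (0 : ℝ) D, 0 ≤ P t
  integrable : IntervalIntegrable P volume 0 D
  temperature_le : ∀ t ∈ Icc (0 : ℝ) D,
    ∫ τ in (0 : ℝ)..t, a * Real.exp (b * τ) * P τ ≤ (Tc - Te) * Real.exp (b * t)
  energy_le : ∀ t ∈ Icc (0 : ℝ) D, ∫ τ in (0 : ℝ)..t, P τ ≤ E

/-- `P` is an optimal policy: feasible, and of the largest throughput among feasible policies. -/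
structure IsOptimal (a b Te Tc E D : ℝ) (P : ℝ → ℝ) : Prop where
  feasible : IsFeasible a b Te Tc E D P
  throughput_le : ∀ Q : ℝ → ℝ, IsFeasible a b Te Tc E D Q → throughput D Q ≤ throughput D P

/-- `T` is the temperature on `[0, D]` under the policy `P` with `T(0) = Te`: the (Carathéodory)
solution of `T' = a P - b (T - Te)`, that is, the continuous solution of the integrated equation. -/
structure IsTemperature (a b Te D : ℝ) (P T : ℝ → ℝ) : Prop where
  continuousOn : ContinuousOn T (Icc (0 : ℝ) D)
  init : T 0 = Te
  eq_integral : ∀ t ∈ Icc (0 : ℝ) D,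
    T t = T 0 + ∫ τ in (0 : ℝ)..t, (a * P τ - b * (T τ - Te))

end HeatedTransmitter

namespace HeatedTransmitter

/-! Averaging a policy over an interval keeps its energy and, since the logarithm is strictly
concave, raises the throughput unless the policy is already a.e. constant there
(`IsOptimal.ae_eq_of_isFeasible_replaceConst`). So an optimal policy is constant on every interval
where averaging stays feasible.

Let `b > 0`. A constant policy has temperature `A + B exp (-b t)`. If `T` lay strictly below such a
profile with the same end values, it would lose less heat than the profile, so its average power
would be smaller than that of the profile. Averaging would then be feasible and end strictly colder
than `T`, although it cannot change an optimal policy. Hence `T` is concave in the variable `x =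
-exp (-b t)` (`IsOptimal.le_temperature_of_mem_Icc`). A similar averaging on a final interval shows
that `T` is largest at `D` (`IsOptimal.temperature_le_final`). Concavity in `x` then makes `T`
monotone, and as `x` is concave in `t`, `T` is concave in `t`. For `b = 0` the policy can be
averaged over all of `[0, D]`. -/

variable {a b Te Tc E D : ℝ} {P T : ℝ → ℝ}

/-! ### The temperature equation -/

theorem intervalIntegrable_exp_mul {s u : ℝ} (hP : IntervalIntegrable P volume s u) :
    IntervalIntegrable (fun τ => a * Real.exp (b * τ) * P τ) volume s u :=
  hP.continuousOn_mul (by fun_prop)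

theorem IsTemperature.intervalIntegrable_rate (hD : 0 ≤ D) (hT : IsTemperature a b Te D P T)
    (hP : IntervalIntegrable P volume 0 D) :
    IntervalIntegrable (fun τ => a * P τ - b * (T τ - Te)) volume 0 D := by
  have hTc : ContinuousOn T (uIcc 0 D) := by rw [uIcc_of_le hD]; exact hT.continuousOn
  have h : ContinuousOn (fun τ => b * (T τ - Te)) (uIcc 0 D) := by fun_prop
  exact (hP.const_mul a).sub h.intervalIntegrable

/-- Subintervals of `[0, D]` inherit integrability. -/
theorem intervalIntegrable_sub {f : ℝ → ℝ} (hf : IntervalIntegrable f volume 0 D) {s u : ℝ}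
    (hs : s ∈ Icc 0 D) (hu : u ∈ Icc 0 D) : IntervalIntegrable f volume s u := by
  refine hf.mono_set (uIcc_subset_uIcc ?_ ?_) <;> rw [uIcc_of_le (hs.1.trans hs.2)] <;> assumption

/-- Heat balance. The power enters only through `∫ P`, so a bound on the heat lost becomes a bound
on the average power. -/
theorem IsTemperature.sub_eq (hT : IsTemperature a b Te D P T)
    (hP : IntervalIntegrable P volume 0 D) {s u : ℝ} (hs : s ∈ Icc 0 D) (hu : u ∈ Icc 0 D) :
    T u - T s = a * (∫ τ in s..u, P τ) - b * ∫ τ in s..u, (T τ - Te) := by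
  have hD : 0 ≤ D := hs.1.trans hs.2
  have h0 : (0 : ℝ) ∈ Icc 0 D := ⟨le_rfl, hD⟩
  have hr := hT.intervalIntegrable_rate hD hP
  have hTc : ContinuousOn T (uIcc 0 D) := by rw [uIcc_of_le hD]; exact hT.continuousOn
  have h : ContinuousOn (fun τ => T τ - Te) (uIcc 0 D) := by fun_prop
  have e := intervalIntegral.integral_add_adjacent_intervals
    (intervalIntegrable_sub hr h0 hs) (intervalIntegrable_sub hr hs hu)
  have e2 : ∫ τ in s..u, (a * P τ - b * (T τ - Te)) =
      a * (∫ τ in s..u, P τ) - b * ∫ τ in s..u, (T τ - Te) := by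
    rw [intervalIntegral.integral_sub ((intervalIntegrable_sub hP hs hu).const_mul a)
      ((intervalIntegrable_sub h.intervalIntegrable hs hu).const_mul b),
      intervalIntegral.integral_const_mul, intervalIntegral.integral_const_mul]
  rw [hT.eq_integral u hu, hT.eq_integral s hs, ← e, ← e2]
  ring

/-- Duhamel's formula for the temperature. -/
theorem IsTemperature.integral_exp_mul (hT : IsTemperature a b Te D P T)
    (hP : IntervalIntegrable P volume 0 D) {u : ℝ} (hu : u ∈ Icc 0 D) :
    ∫ τ in (0 : ℝ)..u, a * Real.exp (b * τ) * P τ = Real.exp (b * u) * (T u - Te) := by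
  have hD : 0 ≤ D := hu.1.trans hu.2
  have h0 : (0 : ℝ) ∈ Icc 0 D := ⟨le_rfl, hD⟩
  have hr := intervalIntegrable_sub (hT.intervalIntegrable_rate hD hP) h0 hu
  set r : ℝ → ℝ := fun τ => a * P τ - b * (T τ - Te) with hrdef
  -- `T - Te` is differentiable only almost everywhere, so the product with `exp (b t)` is
  -- integrated by absolute continuity; the cooling term cancels in its derivative.
  have hg := hr.absolutelyContinuousOnInterval_intervalIntegral (c := 0) (by simp)
  have he : AbsolutelyContinuousOnInterval (fun t => Real.exp (b * t)) 0 u :=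
    ContDiffOn.absolutelyContinuousOnInterval (by fun_prop)
  have key := (he.fun_mul hg).integral_deriv_eq_sub
  have hgu : ∫ τ in (0 : ℝ)..u, r τ = T u - Te := by
    rw [hT.eq_integral u hu, hT.init]; ring
  simp only [intervalIntegral.integral_same, mul_zero, sub_zero, hgu] at key
  rw [← key]
  apply intervalIntegral.integral_congr_ae
  filter_upwards [hr.ae_hasDerivAt_integral] with x hx hxu
  have hxI : x ∈ uIcc 0 u := uIoc_subset_uIcc hxu
  have hd : HasDerivAt (fun t => Real.exp (b * t)) (Real.exp (b * x) * (b * 1)) x :=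
    ((hasDerivAt_id x).const_mul b).exp
  rw [(hd.fun_mul (hx hxI 0 (by simp))).deriv]
  rw [uIcc_of_le hu.1] at hxI
  have hxD : x ∈ Icc 0 D := ⟨hxI.1, hxI.2.trans hu.2⟩
  have hgx : ∫ τ in (0 : ℝ)..x, r τ = T x - Te := by
    rw [hT.eq_integral x hxD, hT.init]; ring
  rw [hgx, hrdef]
  ring

theorem IsFeasible.le_temperature (ha : 0 ≤ a) (hP : IsFeasible a b Te Tc E D P)
    (hT : IsTemperature a b Te D P T) {t : ℝ} (ht : t ∈ Icc 0 D) : Te ≤ T t := by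
  have h := hT.integral_exp_mul hP.integrable ht
  have h2 : 0 ≤ ∫ τ in (0 : ℝ)..t, a * Real.exp (b * τ) * P τ :=
    intervalIntegral.integral_nonneg ht.1 fun τ hτ =>
      mul_nonneg (by positivity) (hP.nonneg τ ⟨hτ.1, hτ.2.trans ht.2⟩)
  rw [h] at h2
  have := nonneg_of_mul_nonneg_right h2 (Real.exp_pos _)
  linarith

theorem IsFeasible.temperature_le_critical (hP : IsFeasible a b Te Tc E D P)
    (hT : IsTemperature a b Te D P T) {t : ℝ} (ht : t ∈ Icc 0 D) : T t ≤ Tc := by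
  have h := hP.temperature_le t ht
  rw [hT.integral_exp_mul hP.integrable ht, mul_comm] at h
  have := le_of_mul_le_mul_right h (Real.exp_pos _)
  linarith

/-! ### Averaging a policy over an interval -/

/-- The policy `P` with its values on `(s, u]` replaced by the constant `q`. -/
noncomputable def replaceConst (P : ℝ → ℝ) (s u q : ℝ) : ℝ → ℝ :=
  fun τ => open Classical in if τ ∈ Ioc s u then q else P τ

/-- The integrand `F` is left general to serve heat, energy and throughput alike. -/
theorem integral_replaceConst_of_outside (F : ℝ → ℝ → ℝ) {s u q x y : ℝ} (hxy : x ≤ y)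
    (h : y ≤ s ∨ u ≤ x) :
    ∫ τ in x..y, F τ (replaceConst P s u q τ) = ∫ τ in x..y, F τ (P τ) := by
  refine intervalIntegral.integral_congr_ae (Filter.Eventually.of_forall fun τ hτ => ?_)
  rw [uIoc_of_le hxy] at hτ
  have : τ ∉ Ioc s u := fun h' => by
    rcases h with h | h
    · linarith [hτ.2, h'.1]
    · linarith [hτ.1, h'.2]
  simp only [replaceConst, if_neg this]

theorem integral_replaceConst_of_inside (F : ℝ → ℝ → ℝ) {s u q x y : ℝ} (hxy : x ≤ y)
    (hs : s ≤ x) (hu : y ≤ u) :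
    ∫ τ in x..y, F τ (replaceConst P s u q τ) = ∫ τ in x..y, F τ q := by
  refine intervalIntegral.integral_congr_ae (Filter.Eventually.of_forall fun τ hτ => ?_)
  rw [uIoc_of_le hxy] at hτ
  have : τ ∈ Ioc s u := ⟨hs.trans_lt hτ.1, hτ.2.trans hu⟩
  simp only [replaceConst, if_pos this]

theorem intervalIntegrable_replaceConst {s u q x y : ℝ} (hP : IntervalIntegrable P volume x y) :
    IntervalIntegrable (replaceConst P s u q) volume x y := by
  classical
  have h1 : IntegrableOn (fun _ : ℝ => q) (uIoc x y) volume :=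
    integrableOn_const (by simp [uIoc])
  rw [intervalIntegrable_iff] at hP ⊢
  have : replaceConst P s u q = (Ioc s u).piecewise (fun _ => q) P := by
    ext τ; simp only [replaceConst, Set.piecewise]
  rw [this]
  refine Integrable.piecewise measurableSet_Ioc ?_ ?_
  · exact h1.integrable.integrableOn
  · exact hP.integrable.integrableOn

theorem intervalIntegrable_logb {s u : ℝ} (hsu : s ≤ u) (h0 : ∀ t ∈ Icc s u, 0 ≤ P t)
    (hP : IntervalIntegrable P volume s u) :
    IntervalIntegrable (fun τ => (1 / 2) * Real.logb 2 (1 + P τ)) volume s u := by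
  refine IntervalIntegrable.const_mul ?_ _
  unfold Real.logb
  refine IntervalIntegrable.div_const ?_ _
  refine hP.mono_fun ?_ ?_
  · exact (Real.measurable_log.comp_aemeasurable
      ((intervalIntegrable_iff.1 hP).aestronglyMeasurable.aemeasurable.const_add 1)).aestronglyMeasurable
  · refine (ae_restrict_iff' measurableSet_uIoc).2 (Filter.Eventually.of_forall fun τ hτ => ?_)
    rw [uIoc_of_le hsu] at hτ
    have h := h0 τ ⟨hτ.1.le, hτ.2⟩
    have := Real.log_nonneg (x := 1 + P τ) (by linarith)
    have h2 := Real.log_le_sub_one_of_pos (x := 1 + P τ) (by linarith)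
    simp only [Real.norm_of_nonneg this, Real.norm_of_nonneg h]
    linarith

theorem log_one_add_le_tangent {p q : ℝ} (hp : 0 ≤ p) (hq : 0 ≤ q) :
    Real.log (1 + p) ≤ Real.log (1 + q) + (p - q) / (1 + q) := by
  have h := Real.log_le_sub_one_of_pos (x := (1 + p) / (1 + q)) (by positivity)
  rw [Real.log_div (by positivity) (by positivity)] at h
  have : (1 + p) / (1 + q) - 1 = (p - q) / (1 + q) := by field_simp; ring
  linarith

theorem eq_of_log_one_add_eq_tangent {p q : ℝ} (hp : 0 ≤ p) (hq : 0 ≤ q)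
    (h : Real.log (1 + p) = Real.log (1 + q) + (p - q) / (1 + q)) : p = q := by
  by_contra hne
  have h1 : (1 + p) / (1 + q) ≠ 1 := by
    rw [Ne, div_eq_one_iff_eq (by positivity)]
    intro h'; apply hne; linarith
  have h := Real.log_lt_sub_one_of_pos (x := (1 + p) / (1 + q)) (by positivity) h1
  rw [Real.log_div (by positivity) (by positivity)] at h
  have : (1 + p) / (1 + q) - 1 = (p - q) / (1 + q) := by field_simp; ring
  linarith

/-- Replacing a policy by its average on an interval stays feasible if the temperature constraint
holds on the interval and no more heat is left at its end. -/
theorem IsFeasible.replaceConst (hP : IsFeasible a b Te Tc E D P) {s u q : ℝ} (hs : 0 ≤ s)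
    (hsu : s < u) (hu : u ≤ D) (hq : q * (u - s) = ∫ τ in s..u, P τ)
    (hM : ∀ t ∈ Icc s u, (∫ τ in (0 : ℝ)..s, a * Real.exp (b * τ) * P τ) +
      (∫ τ in s..t, a * Real.exp (b * τ) * q) ≤ (Tc - Te) * Real.exp (b * t))
    (hend : u = D ∨ (∫ τ in s..u, a * Real.exp (b * τ) * q) ≤
      ∫ τ in s..u, a * Real.exp (b * τ) * P τ) :
    IsFeasible a b Te Tc E D (replaceConst P s u q) := by
  have hI := hP.integrable
  have h0 : (0 : ℝ) ∈ Icc 0 D := ⟨le_rfl, by linarith⟩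
  have hsD : s ∈ Icc 0 D := ⟨hs, by linarith⟩
  have huD : u ∈ Icc 0 D := ⟨by linarith, hu⟩
  have hq0 : 0 ≤ q := by
    have : 0 ≤ ∫ τ in s..u, P τ := intervalIntegral.integral_nonneg hsu.le fun τ hτ =>
      hP.nonneg τ ⟨hs.trans hτ.1, hτ.2.trans hu⟩
    rw [← hq] at this
    exact nonneg_of_mul_nonneg_left this (by linarith)
  have hIQ : IntervalIntegrable (HeatedTransmitter.replaceConst P s u q) volume 0 D :=
    intervalIntegrable_replaceConst hI
  have hIe : IntervalIntegrable (fun τ => a * Real.exp (b * τ) * P τ) volume 0 D :=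
    intervalIntegrable_exp_mul hI
  have hIQe : IntervalIntegrable
      (fun τ => a * Real.exp (b * τ) * HeatedTransmitter.replaceConst P s u q τ) volume 0 D :=
    intervalIntegrable_exp_mul hIQ
  refine ⟨fun t ht => ?_, hIQ, fun t ht => ?_, fun t ht => ?_⟩
  · unfold HeatedTransmitter.replaceConst
    split_ifs
    exacts [hq0, hP.nonneg t ht]
  · set F : ℝ → ℝ → ℝ := fun τ p => a * Real.exp (b * τ) * p with hF
    rcases le_total t s with hts | hts
    · have := integral_replaceConst_of_outside (P := P) (q := q) (u := u) F ht.1 (Or.inl hts)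
      simp only [hF] at this
      rw [this]; exact hP.temperature_le t ht
    have e1 := integral_replaceConst_of_outside (P := P) (q := q) (u := u) F hs (Or.inl le_rfl)
    rcases le_total t u with htu | htu
    · have e2 := integral_replaceConst_of_inside (P := P) (q := q) F hts le_rfl htu
      simp only [hF] at e1 e2
      rw [← intervalIntegral.integral_add_adjacent_intervals (intervalIntegrable_sub hIQe h0 hsD)
        (intervalIntegrable_sub hIQe hsD ht), e1, e2]
      exact hM t ⟨hts, htu⟩
    have e2 := integral_replaceConst_of_inside (P := P) (q := q) F hsu.le le_rfl le_rfl
    have e3 := integral_replaceConst_of_outside (P := P) (q := q) (s := s) F htu (Or.inr le_rfl)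
    simp only [hF] at e1 e2 e3
    -- If `u = D`, no later time can suffer from additional heat.
    rcases hend with rfl | hend
    · obtain rfl : t = u := le_antisymm ht.2 htu
      rw [← intervalIntegral.integral_add_adjacent_intervals (intervalIntegrable_sub hIQe h0 hsD)
        (intervalIntegrable_sub hIQe hsD ht), e1, e2]
      exact hM t ⟨hts, le_rfl⟩
    · have h := hP.temperature_le t ht
      rw [← intervalIntegral.integral_add_adjacent_intervals (intervalIntegrable_sub hIe h0 huD)
        (intervalIntegrable_sub hIe huD ht), ← intervalIntegral.integral_add_adjacent_intervals
        (intervalIntegrable_sub hIe h0 hsD) (intervalIntegrable_sub hIe hsD huD)] at h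
      rw [← intervalIntegral.integral_add_adjacent_intervals (intervalIntegrable_sub hIQe h0 huD)
        (intervalIntegrable_sub hIQe huD ht), ← intervalIntegral.integral_add_adjacent_intervals
        (intervalIntegrable_sub hIQe h0 hsD) (intervalIntegrable_sub hIQe hsD huD), e1, e2, e3]
      linarith
  · set F : ℝ → ℝ → ℝ := fun τ p => p with hF
    rcases le_total t s with hts | hts
    · have := integral_replaceConst_of_outside (P := P) (q := q) (u := u) F ht.1 (Or.inl hts)
      simp only [hF] at this
      rw [this]; exact hP.energy_le t ht
    have e1 := integral_replaceConst_of_outside (P := P) (q := q) (u := u) F hs (Or.inl le_rfl)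
    rcases le_total t u with htu | htu
    · have e2 := integral_replaceConst_of_inside (P := P) (q := q) F hts le_rfl htu
      simp only [hF, intervalIntegral.integral_const, smul_eq_mul] at e1 e2
      have h := hP.energy_le u huD
      rw [← intervalIntegral.integral_add_adjacent_intervals (intervalIntegrable_sub hI h0 hsD)
        (intervalIntegrable_sub hI hsD huD), ← hq] at h
      rw [← intervalIntegral.integral_add_adjacent_intervals (intervalIntegrable_sub hIQ h0 hsD)
        (intervalIntegrable_sub hIQ hsD ht), e1, e2]
      have := mul_le_mul_of_nonneg_left (sub_le_sub_right htu s) hq0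
      linarith
    have e2 := integral_replaceConst_of_inside (P := P) (q := q) F hsu.le le_rfl le_rfl
    have e3 := integral_replaceConst_of_outside (P := P) (q := q) (s := s) F htu (Or.inr le_rfl)
    simp only [hF, intervalIntegral.integral_const, smul_eq_mul] at e1 e2 e3
    have h := hP.energy_le t ht
    rw [← intervalIntegral.integral_add_adjacent_intervals (intervalIntegrable_sub hI h0 huD)
      (intervalIntegrable_sub hI huD ht), ← intervalIntegral.integral_add_adjacent_intervals
      (intervalIntegrable_sub hI h0 hsD) (intervalIntegrable_sub hI hsD huD), ← hq] at h
    rw [← intervalIntegral.integral_add_adjacent_intervals (intervalIntegrable_sub hIQ h0 huD)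
      (intervalIntegrable_sub hIQ huD ht), ← intervalIntegral.integral_add_adjacent_intervals
      (intervalIntegrable_sub hIQ h0 hsD) (intervalIntegrable_sub hIQ hsD huD), e1, e2, e3]
    linarith

/-- Strict concavity of the throughput: an optimal policy is constant on every interval on which it
can be averaged. -/
theorem IsOptimal.ae_eq_of_isFeasible_replaceConst (hP : IsOptimal a b Te Tc E D P) {s u q : ℝ}
    (hs : 0 ≤ s) (hsu : s < u) (hu : u ≤ D) (hq : q * (u - s) = ∫ τ in s..u, P τ)
    (hQ : IsFeasible a b Te Tc E D (replaceConst P s u q)) :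
    ∀ᵐ τ ∂volume.restrict (Ioc s u), P τ = q := by
  have hI := hP.feasible.integrable
  have hn := hP.feasible.nonneg
  have h0 : (0 : ℝ) ∈ Icc 0 D := ⟨le_rfl, by linarith⟩
  have hDD : D ∈ Icc 0 D := ⟨by linarith, le_rfl⟩
  have hsD : s ∈ Icc 0 D := ⟨hs, by linarith⟩
  have huD : u ∈ Icc 0 D := ⟨by linarith, hu⟩
  have hq0 : 0 ≤ q := by
    have : 0 ≤ ∫ τ in s..u, P τ := intervalIntegral.integral_nonneg hsu.le fun τ hτ =>
      hn τ ⟨hs.trans hτ.1, hτ.2.trans hu⟩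
    rw [← hq] at this
    exact nonneg_of_mul_nonneg_left this (by linarith)
  have hl := intervalIntegrable_logb hDD.1 hn hI
  have hlQ := intervalIntegrable_logb hDD.1 hQ.nonneg hQ.integrable
  have hJ := hP.throughput_le _ hQ
  unfold throughput at hJ
  set F : ℝ → ℝ → ℝ := fun _ p => (1 / 2) * Real.logb 2 (1 + p) with hF
  have e1 := integral_replaceConst_of_outside (P := P) (q := q) (u := u) F hs (Or.inl le_rfl)
  have e2 := integral_replaceConst_of_inside (P := P) (q := q) F hsu.le le_rfl le_rfl
  have e3 := integral_replaceConst_of_outside (P := P) (q := q) (s := s) F hu (Or.inr le_rfl)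
  simp only [hF] at e1 e2 e3
  rw [← intervalIntegral.integral_add_adjacent_intervals (intervalIntegrable_sub hl h0 huD)
      (intervalIntegrable_sub hl huD hDD), ← intervalIntegral.integral_add_adjacent_intervals
      (intervalIntegrable_sub hl h0 hsD) (intervalIntegrable_sub hl hsD huD),
      ← intervalIntegral.integral_add_adjacent_intervals (intervalIntegrable_sub hlQ h0 huD)
      (intervalIntegrable_sub hlQ huD hDD), ← intervalIntegral.integral_add_adjacent_intervals
      (intervalIntegrable_sub hlQ h0 hsD) (intervalIntegrable_sub hlQ hsD huD), e1, e2, e3] at hJ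
  have hl' : IntervalIntegrable (fun τ => Real.log (1 + P τ)) volume s u := by
    have := ((intervalIntegrable_sub hl hsD huD).const_mul 2).mul_const (Real.log 2)
    refine this.congr (fun τ _ => ?_)
    have : Real.log 2 ≠ 0 := (Real.log_pos (by norm_num)).ne'
    simp only [Real.logb]; field_simp
  have hJ' : ∫ _ in s..u, Real.log (1 + q) ≤ ∫ τ in s..u, Real.log (1 + P τ) := by
    have h2 : ∫ _ in s..u, 1 / 2 * Real.logb 2 (1 + q) ≤
      ∫ τ in s..u, 1 / 2 * Real.logb 2 (1 + P τ) := by linarith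
    simp only [Real.logb, intervalIntegral.integral_const_mul,
      intervalIntegral.integral_div] at h2
    have h3 : (0 : ℝ) < 1 / 2 := by norm_num
    exact (div_le_div_iff_of_pos_right (Real.log_pos (by norm_num))).1
      (le_of_mul_le_mul_left h2 h3)
  have hPs := intervalIntegrable_sub hI hsD huD
  have ht : IntervalIntegrable (fun τ => Real.log (1 + q) + (P τ - q) / (1 + q)) volume s u :=
    intervalIntegrable_const.add ((hPs.sub intervalIntegrable_const).div_const _)
  have hG : IntervalIntegrable (fun τ => Real.log (1 + q) + (P τ - q) / (1 + q) -
      Real.log (1 + P τ)) volume s u := ht.sub hl'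
  have hnn : ∀ τ ∈ Ioc s u, 0 ≤ Real.log (1 + q) + (P τ - q) / (1 + q) - Real.log (1 + P τ) :=
    fun τ hτ => sub_nonneg.2 (log_one_add_le_tangent (hn τ ⟨by linarith [hτ.1], hτ.2.trans hu⟩) hq0)
  have hae : 0 ≤ᵐ[volume.restrict (Ioc s u)] fun τ => Real.log (1 + q) + (P τ - q) / (1 + q) -
      Real.log (1 + P τ) := (ae_restrict_iff' measurableSet_Ioc).2 (Filter.Eventually.of_forall hnn)
  -- The linear term of the tangent at the mean `q` integrates to zero, so optimality forces the
  -- nonnegative gap between tangent and logarithm to have integral zero.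
  have hint : ∫ τ in s..u, (Real.log (1 + q) + (P τ - q) / (1 + q) - Real.log (1 + P τ)) = 0 := by
    refine le_antisymm ?_ (intervalIntegral.integral_nonneg_of_ae_restrict hsu.le ?_)
    · rw [intervalIntegral.integral_sub ht hl', intervalIntegral.integral_add
        intervalIntegrable_const ((hPs.sub intervalIntegrable_const).div_const _),
        intervalIntegral.integral_div, intervalIntegral.integral_sub hPs intervalIntegrable_const,
        ← hq]
      simp only [intervalIntegral.integral_const, smul_eq_mul] at hJ' ⊢
      have : (q * (u - s) - (u - s) * q) / (1 + q) = 0 := by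
        rw [mul_comm, sub_self, zero_div]
      linarith
    · rwa [restrict_Ioc_eq_restrict_Icc] at hae
  rw [intervalIntegral.integral_eq_zero_iff_of_le_of_nonneg_ae hsu.le hae hG] at hint
  filter_upwards [hint, ae_restrict_mem measurableSet_Ioc] with τ h1 h2
  refine eq_of_log_one_add_eq_tangent (hn τ ⟨by linarith [h2.1], h2.2.trans hu⟩) hq0 ?_
  exact (sub_eq_zero.1 h1).symm

/-! ### Temperature profiles of constant policies, `b > 0` -/

theorem integral_exp_mul_const (hb : b ≠ 0) (q s t : ℝ) :
    ∫ τ in s..t, a * Real.exp (b * τ) * q =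
      a * q / b * (Real.exp (b * t) - Real.exp (b * s)) := by
  rw [intervalIntegral.integral_mul_const, intervalIntegral.integral_const_mul,
    intervalIntegral.integral_comp_mul_left (fun x => Real.exp x) hb, integral_exp, smul_eq_mul]
  field_simp

/-- If averaging an optimal policy on an interval respects the temperature constraint, the
temperature on this interval is that of a constant policy. -/
theorem IsOptimal.exp_mul_temperature_eq (hb : 0 < b) (hP : IsOptimal a b Te Tc E D P)
    (hT : IsTemperature a b Te D P T) {s u q : ℝ} (hs : 0 ≤ s) (hsu : s < u) (hu : u ≤ D)
    (hq : q * (u - s) = ∫ τ in s..u, P τ)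
    (hM : ∀ t ∈ Icc s u, Real.exp (b * s) * (T s - Te) +
      a * q / b * (Real.exp (b * t) - Real.exp (b * s)) ≤ (Tc - Te) * Real.exp (b * t))
    (hend : u = D ∨ Real.exp (b * s) * (T s - Te) +
      a * q / b * (Real.exp (b * u) - Real.exp (b * s)) ≤ Real.exp (b * u) * (T u - Te))
    {t : ℝ} (ht : t ∈ Icc s u) :
    Real.exp (b * t) * (T t - Te) = Real.exp (b * s) * (T s - Te) +
      a * q / b * (Real.exp (b * t) - Real.exp (b * s)) := by
  have hI := hP.feasible.integrable
  have h0 : (0 : ℝ) ∈ Icc 0 D := ⟨le_rfl, by linarith⟩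
  have hsD : s ∈ Icc 0 D := ⟨hs, by linarith⟩
  have hIe : IntervalIntegrable (fun τ => a * Real.exp (b * τ) * P τ) volume 0 D :=
    intervalIntegrable_exp_mul hI
  have hmem : ∀ t ∈ Icc s u, t ∈ Icc 0 D := fun t ht => ⟨hs.trans ht.1, ht.2.trans hu⟩
  have heat : ∀ t ∈ Icc s u, ∫ τ in s..t, a * Real.exp (b * τ) * P τ =
      Real.exp (b * t) * (T t - Te) - Real.exp (b * s) * (T s - Te) := fun t ht => by
    have h := intervalIntegral.integral_add_adjacent_intervals
      (intervalIntegrable_sub hIe h0 hsD) (intervalIntegrable_sub hIe hsD (hmem t ht))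
    rw [hT.integral_exp_mul hI hsD, hT.integral_exp_mul hI (hmem t ht)] at h
    linarith
  have hQ := hP.feasible.replaceConst hs hsu hu hq
    (fun t ht => by
      rw [hT.integral_exp_mul hI hsD, integral_exp_mul_const hb.ne']; exact hM t ht)
    (hend.imp id fun h => by
      rw [heat u ⟨hsu.le, le_rfl⟩, integral_exp_mul_const hb.ne']; linarith)
  have hae := hP.ae_eq_of_isFeasible_replaceConst hs hsu hu hq hQ
  have : ∫ τ in s..t, a * Real.exp (b * τ) * P τ = ∫ τ in s..t, a * Real.exp (b * τ) * q := by
    refine intervalIntegral.integral_congr_ae ?_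
    filter_upwards [(ae_restrict_iff' measurableSet_Ioc).1 hae] with τ h1 h2
    rw [uIoc_of_le ht.1] at h2
    rw [h1 ⟨h2.1, h2.2.trans ht.2⟩]
  rw [heat t ht, integral_exp_mul_const hb.ne'] at this
  linarith

theorem average_mul_sub {s u : ℝ} (hsu : s < u) (f : ℝ → ℝ) :
    (∫ τ in s..u, f τ) / (u - s) * (u - s) = ∫ τ in s..u, f τ :=
  div_mul_cancel₀ _ (sub_pos.2 hsu).ne'

theorem IsTemperature.intervalIntegrable_sub_const (hT : IsTemperature a b Te D P T) {s u : ℝ}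
    (hs : s ∈ Icc 0 D) (hu : u ∈ Icc 0 D) :
    IntervalIntegrable (fun τ => T τ - Te) volume s u := by
  have h : ContinuousOn T (uIcc s u) := hT.continuousOn.mono (uIcc_subset_Icc hs hu)
  exact (h.sub continuousOn_const).intervalIntegrable

/-! ### The final temperature is the largest -/

/-- Once the temperature has reached its final value, it stays there. -/
theorem IsOptimal.temperature_eq_final (hb : 0 < b) (hP : IsOptimal a b Te Tc E D P)
    (hT : IsTemperature a b Te D P T) {s t : ℝ} (hs : s ∈ Icc 0 D) (hsT : T s = T D)
    (ht : t ∈ Icc s D) : T t = T D := by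
  rcases hs.2.eq_or_lt with rfl | hsD
  · rw [le_antisymm ht.2 ht.1]
  have hDD : D ∈ Icc 0 D := ⟨hs.1.trans hs.2, le_rfl⟩
  have hB := hT.sub_eq hP.feasible.integrable hs hDD
  set q := (∫ τ in s..D, P τ) / (D - s)
  have hq : q * (D - s) = ∫ τ in s..D, P τ := average_mul_sub hsD P
  have hint : ∫ τ in s..D, (T τ - Te) ≤ (D - s) * (Tc - Te) := by
    have := intervalIntegral.integral_mono_on (g := fun _ => Tc - Te) hsD.le
      (hT.intervalIntegrable_sub_const hs hDD) intervalIntegrable_const fun τ hτ =>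
        sub_le_sub_right (hP.feasible.temperature_le_critical hT
          ⟨hs.1.trans hτ.1, hτ.2⟩) Te
    rwa [intervalIntegral.integral_const, smul_eq_mul] at this
  -- `Te + a q / b` is the equilibrium temperature at power `q`. As `T s = T D`, the heat supplied
  -- equals the heat lost, so this equilibrium is the mean of `T` on `[s, D]`.
  have hc : a * q / b ≤ Tc - Te := by
    rw [div_le_iff₀ hb]
    refine le_of_mul_le_mul_right ?_ (sub_pos.2 hsD)
    have := mul_le_mul_of_nonneg_left hint hb.le
    rw [← hq, hsT] at hB
    linarith
  set c := a * q / b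
  have hsM := hP.feasible.temperature_le_critical hT hs
  have hH : ∀ t ∈ Icc s D, Real.exp (b * s) * (T s - Te) +
      c * (Real.exp (b * t) - Real.exp (b * s)) ≤ (Tc - Te) * Real.exp (b * t) := fun t ht => by
    have h1 : Real.exp (b * s) ≤ Real.exp (b * t) :=
      Real.exp_le_exp.2 (mul_le_mul_of_nonneg_left ht.1 hb.le)
    have h2 := mul_le_mul_of_nonneg_right hc (sub_nonneg.2 h1)
    have h3 := mul_le_mul_of_nonneg_left hsM (Real.exp_pos (b * s)).le
    linarith
  have hD := hP.exp_mul_temperature_eq hb hT hs.1 hsD le_rfl hq hH (Or.inl rfl) ⟨hsD.le, le_rfl⟩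
  have ht' := hP.exp_mul_temperature_eq hb hT hs.1 hsD le_rfl hq hH (Or.inl rfl) ht
  have hlt : Real.exp (b * s) < Real.exp (b * D) :=
    Real.exp_lt_exp.2 (mul_lt_mul_of_pos_left hsD hb)
  rw [hsT] at hD ht'
  -- A constant policy with equal temperatures at both ends sits at its equilibrium.
  have hcD : T D - Te = c := by
    refine mul_right_cancel₀ (sub_pos.2 hlt).ne' ?_
    linarith
  have : T t - Te = c := by
    refine mul_left_cancel₀ (Real.exp_pos (b * t)).ne' ?_
    rw [ht', hcD]; ring
  linarith

theorem IsOptimal.temperature_le_final (ha : 0 ≤ a) (hb : 0 < b)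
    (hP : IsOptimal a b Te Tc E D P) (hT : IsTemperature a b Te D P T) {t : ℝ}
    (ht : t ∈ Icc 0 D) : T t ≤ T D := by
  by_contra! h
  have hDD : D ∈ Icc 0 D := ⟨ht.1.trans ht.2, le_rfl⟩
  have h0 : T 0 ≤ T D := hT.init.trans_le (hP.feasible.le_temperature ha hT hDD)
  obtain ⟨s, hs, hsT⟩ := intermediate_value_Icc ht.1
    (hT.continuousOn.mono (Icc_subset_Icc_right ht.2)) ⟨h0, h.le⟩
  exact h.ne' (hP.temperature_eq_final hb hT ⟨hs.1, hs.2.trans ht.2⟩ hsT ⟨hs.2, ht.2⟩)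

/-! ### Concavity in the variable `-exp (-b t)` -/

/-- A continuous function that vanishes at the ends of an interval and is negative somewhere in
between is negative exactly inside some subinterval at whose ends it vanishes. -/
theorem exists_Ioo_neg {d : ℝ → ℝ} {s p u : ℝ} (hd : ContinuousOn d (Icc s u)) (hp : p ∈ Icc s u)
    (hds : 0 ≤ d s) (hdu : 0 ≤ d u) (hdp : d p < 0) :
    ∃ s' u', s ≤ s' ∧ s' < u' ∧ u' ≤ u ∧ d s' = 0 ∧ d u' = 0 ∧ ∀ t ∈ Ioo s' u', d t < 0 := by
  have hd1 : ContinuousOn d (Icc s p) := hd.mono (Icc_subset_Icc_right hp.2)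
  have hd2 : ContinuousOn d (Icc p u) := hd.mono (Icc_subset_Icc_left hp.1)
  -- `s'` is the last point before `p`, and `u'` the first after `p`, where `d` is nonnegative.
  obtain ⟨s', ⟨hs', hs'0⟩, hs'm⟩ := (isCompact_Icc.of_isClosed_subset
    (hd1.preimage_isClosed_of_isClosed isClosed_Icc isClosed_Ici)
    inter_subset_left).exists_isGreatest (s := Icc s p ∩ d ⁻¹' Ici 0) ⟨s, ⟨le_rfl, hp.1⟩, hds⟩
  obtain ⟨u', ⟨hu', hu'0⟩, hu'm⟩ := (isCompact_Icc.of_isClosed_subset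
    (hd2.preimage_isClosed_of_isClosed isClosed_Icc isClosed_Ici)
    inter_subset_left).exists_isLeast (s := Icc p u ∩ d ⁻¹' Ici 0) ⟨u, ⟨hp.2, le_rfl⟩, hdu⟩
  have hs'p : s' < p := hs'.2.lt_of_ne fun h => by
    rw [h] at hs'0; exact absurd hdp (not_lt.2 hs'0)
  have hpu' : p < u' := hu'.1.lt_of_ne fun h => by
    rw [← h] at hu'0; exact absurd hdp (not_lt.2 hu'0)
  refine ⟨s', u', hs'.1, hs'p.trans hpu', hu'.2, ?_, ?_, fun t ht => ?_⟩
  · obtain ⟨t, ht, ht0⟩ := intermediate_value_Icc' hs'.2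
      (hd1.mono (Icc_subset_Icc_left hs'.1)) ⟨hdp.le, hs'0⟩
    have : t ≤ s' := hs'm ⟨⟨hs'.1.trans ht.1, ht.2⟩, ht0.ge⟩
    rwa [le_antisymm this ht.1] at ht0
  · obtain ⟨t, ht, ht0⟩ := intermediate_value_Icc hu'.1
      (hd2.mono (Icc_subset_Icc_right hu'.2)) ⟨hdp.le, hu'0⟩
    have : u' ≤ t := hu'm ⟨⟨ht.1, ht.2.trans hu'.2⟩, ht0.ge⟩
    rwa [le_antisymm ht.2 this] at ht0
  · by_contra! h
    rcases le_total t p with htp | htp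
    · exact ht.1.not_ge (hs'm ⟨⟨hs'.1.trans ht.1.le, htp⟩, h⟩)
    · exact ht.2.not_ge (hu'm ⟨⟨htp, ht.2.le.trans hu'.2⟩, h⟩)

theorem integral_add_exp_neg (hb : b ≠ 0) (A B s u : ℝ) :
    ∫ τ in s..u, (A + B * Real.exp (-b * τ)) =
      A * (u - s) - B / b * (Real.exp (-b * u) - Real.exp (-b * s)) := by
  rw [intervalIntegral.integral_add intervalIntegrable_const
    (Continuous.intervalIntegrable (by fun_prop) _ _), intervalIntegral.integral_const_mul,
    intervalIntegral.integral_comp_mul_left (fun x => Real.exp x) (neg_ne_zero.2 hb), integral_exp,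
    intervalIntegral.integral_const, smul_eq_mul, smul_eq_mul]
  field_simp
  ring

/-- The temperature under an optimal policy does not stay strictly below the temperature profile of
a constant policy with the same end values. -/
theorem IsOptimal.not_forall_temperature_lt (hb : 0 < b) (hP : IsOptimal a b Te Tc E D P)
    (hT : IsTemperature a b Te D P T) {s u A B : ℝ} (hs : 0 ≤ s) (hsu : s < u) (hu : u ≤ D)
    (hsT : T s - Te = A + B * Real.exp (-b * s)) (huT : T u - Te = A + B * Real.exp (-b * u)) :
    ¬ ∀ t ∈ Ioo s u, T t - Te < A + B * Real.exp (-b * t) := by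
  intro hlt
  have hsD : s ∈ Icc 0 D := ⟨hs, by linarith⟩
  have huD : u ∈ Icc 0 D := ⟨by linarith, hu⟩
  have hB := hT.sub_eq hP.feasible.integrable hsD huD
  set q := (∫ τ in s..u, P τ) / (u - s)
  have hq : q * (u - s) = ∫ τ in s..u, P τ := average_mul_sub hsu P
  have hTc : ContinuousOn T (Icc s u) := hT.continuousOn.mono (Icc_subset_Icc hs hu)
  have hint : ∫ τ in s..u, (T τ - Te) < ∫ τ in s..u, (A + B * Real.exp (-b * τ)) := by
    obtain ⟨p, hp⟩ := nonempty_Ioo.2 hsu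
    refine intervalIntegral.integral_lt_integral_of_continuousOn_of_le_of_exists_lt hsu
      (by fun_prop) (by fun_prop) (fun t ht => ?_) ⟨p, Ioo_subset_Icc_self hp, hlt p hp⟩
    rcases ht.2.eq_or_lt with rfl | h
    · exact huT.le
    · exact (hlt t ⟨ht.1, h⟩).le
  rw [integral_add_exp_neg hb.ne'] at hint
  -- The profile has equilibrium `A` above `Te`; the same temperature change with less heat lost
  -- needs less power.
  have hc : a * q / b < A := by
    rw [div_lt_iff₀ hb]
    refine lt_of_mul_lt_mul_right ?_ (sub_pos.2 hsu).le
    have h1 := mul_lt_mul_of_pos_left hint hb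
    have h2 : b * (A * (u - s) - B / b * (Real.exp (-b * u) - Real.exp (-b * s))) =
        b * A * (u - s) - B * (Real.exp (-b * u) - Real.exp (-b * s)) := by field_simp
    rw [← hq] at hB
    linarith
  set c := a * q / b
  have hsM := hP.feasible.temperature_le_critical hT hsD
  have huM := hP.feasible.temperature_le_critical hT huD
  have hexp : ∀ t, Real.exp (b * t) * Real.exp (-b * t) = 1 := fun t => by
    rw [← Real.exp_add]; simp
  have hinc : Real.exp (b * s) < Real.exp (b * u) :=
    Real.exp_lt_exp.2 (mul_lt_mul_of_pos_left hsu hb)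
  have hHu : Real.exp (b * s) * (T s - Te) + c * (Real.exp (b * u) - Real.exp (b * s)) <
      Real.exp (b * u) * (T u - Te) := by
    have h1 : Real.exp (b * s) * (T s - Te) = A * Real.exp (b * s) + B := by
      rw [hsT, mul_add, mul_left_comm, hexp]; ring
    have h2 : Real.exp (b * u) * (T u - Te) = A * Real.exp (b * u) + B := by
      rw [huT, mul_add, mul_left_comm, hexp]; ring
    have := mul_lt_mul_of_pos_right hc (sub_pos.2 hinc)
    linarith
  refine hHu.ne' (hP.exp_mul_temperature_eq hb hT hs hsu hu hq (fun t ht => ?_) (Or.inr hHu.le)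
    ⟨hsu.le, le_rfl⟩)
  change Real.exp (b * s) * (T s - Te) + c * (Real.exp (b * t) - Real.exp (b * s)) ≤ _
  have hst : Real.exp (b * s) ≤ Real.exp (b * t) :=
    Real.exp_le_exp.2 (mul_le_mul_of_nonneg_left ht.1 hb.le)
  have htu : Real.exp (b * t) ≤ Real.exp (b * u) :=
    Real.exp_le_exp.2 (mul_le_mul_of_nonneg_left ht.2 hb.le)
  -- If the equilibrium is at most `Tc`, the bound propagates forward from `s`; otherwise the
  -- averaged temperature rises towards it, and the bound propagates backward from `u`.
  rcases le_total c (Tc - Te) with hcM | hcM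
  · have h2 := mul_le_mul_of_nonneg_right hcM (sub_nonneg.2 hst)
    have h3 := mul_le_mul_of_nonneg_left hsM (Real.exp_pos (b * s)).le
    linarith
  · have h2 := mul_le_mul_of_nonneg_right hcM (sub_nonneg.2 htu)
    have h3 := mul_le_mul_of_nonneg_left huM (Real.exp_pos (b * u)).le
    linarith

/-- The temperature under an optimal policy is concave in the time change `t ↦ -exp (-b t)`. -/
theorem IsOptimal.le_temperature_of_mem_Icc (hb : 0 < b) (hP : IsOptimal a b Te Tc E D P)
    (hT : IsTemperature a b Te D P T) {s p u : ℝ} (hs : 0 ≤ s) (hsu : s < u) (hu : u ≤ D)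
    (hp : p ∈ Icc s u) :
    T s + (T u - T s) * ((Real.exp (-b * s) - Real.exp (-b * p)) /
      (Real.exp (-b * s) - Real.exp (-b * u))) ≤ T p := by
  have hlt : Real.exp (-b * u) < Real.exp (-b * s) :=
    Real.exp_lt_exp.2 (mul_lt_mul_of_neg_left hsu (neg_lt_zero.2 hb))
  have hne := (sub_pos.2 hlt).ne'
  -- `A + B exp (-b t)` is the chord of `T` in the variable `-exp (-b t)`.
  set B := -(T u - T s) / (Real.exp (-b * s) - Real.exp (-b * u)) with hBdef
  set A := T s - B * Real.exp (-b * s) with hAdef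
  have hTc : ContinuousOn T (Icc s u) := hT.continuousOn.mono (Icc_subset_Icc hs hu)
  by_contra! h
  have e : ∀ t, T s + (T u - T s) * ((Real.exp (-b * s) - Real.exp (-b * t)) /
      (Real.exp (-b * s) - Real.exp (-b * u))) = A + B * Real.exp (-b * t) := fun t => by
    rw [hAdef, hBdef]; field_simp; ring
  have eu := e u
  rw [div_self hne] at eu
  rw [e] at h
  obtain ⟨s', u', h1, h2, h3, h4, h5, h6⟩ := exists_Ioo_neg
    (d := fun t => T t - (A + B * Real.exp (-b * t))) (by fun_prop) hp
    (by simp [hAdef]) (by linarith) (by linarith)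
  refine hP.not_forall_temperature_lt (A := A - Te) (B := B) hb hT (hs.trans h1) h2 (h3.trans hu)
    (by linarith) (by linarith) fun t ht => ?_
  have := h6 t ht
  linarith

/-! ### Monotonicity and concavity in time -/

theorem IsOptimal.monotoneOn_temperature (ha : 0 ≤ a) (hb : 0 < b)
    (hP : IsOptimal a b Te Tc E D P) (hT : IsTemperature a b Te D P T) :
    MonotoneOn T (Icc 0 D) := by
  intro s hs p hp hsp
  rcases hp.2.eq_or_lt with rfl | hpD
  · exact hP.temperature_le_final ha hb hT hs
  -- The chord from `s` to `D` does not descend, because `T s ≤ T D`, and `T p` lies on or above it.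
  have h := hP.le_temperature_of_mem_Icc hb hT hs.1 (hsp.trans_lt hpD) le_rfl ⟨hsp, hpD.le⟩
  have h1 := hP.temperature_le_final ha hb hT hs
  refine le_trans (le_add_of_nonneg_right (mul_nonneg (sub_nonneg.2 h1) (div_nonneg ?_ ?_))) h
  · exact sub_nonneg.2 (Real.exp_le_exp.2 (by nlinarith))
  · exact sub_nonneg.2 (Real.exp_le_exp.2 (by nlinarith))

theorem IsOptimal.concaveOn_temperature (ha : 0 ≤ a) (hb : 0 < b)
    (hP : IsOptimal a b Te Tc E D P) (hT : IsTemperature a b Te D P T) :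
    ConcaveOn ℝ (Icc 0 D) T := by
  refine LinearOrder.concaveOn_of_lt (convex_Icc _ _) fun s hs u hu hsu α β hα hβ hαβ => ?_
  simp only [smul_eq_mul]
  have hα' : α = 1 - β := by linarith
  have hp : α * s + β * u ∈ Icc s u := by
    subst hα'
    constructor <;> nlinarith
  have h := hP.le_temperature_of_mem_Icc hb hT hs.1 hsu hu.2 hp
  refine le_trans ?_ h
  have hlt : Real.exp (-b * u) < Real.exp (-b * s) :=
    Real.exp_lt_exp.2 (mul_lt_mul_of_neg_left hsu (neg_lt_zero.2 hb))
  have hconv := convexOn_exp.2 (mem_univ (-b * s)) (mem_univ (-b * u)) hα.le hβ.le hαβ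
  simp only [smul_eq_mul] at hconv
  -- By convexity of `exp`, the point has covered at least the fraction `β` of the way in the new
  -- variable; as `T s ≤ T u`, this only raises the chord.
  have hl : β ≤ (Real.exp (-b * s) - Real.exp (-b * (α * s + β * u))) /
      (Real.exp (-b * s) - Real.exp (-b * u)) := by
    rw [le_div_iff₀ (sub_pos.2 hlt)]
    rw [show α * (-b * s) + β * (-b * u) = -b * (α * s + β * u) by ring, hα'] at hconv
    rw [hα']
    linarith
  have hmono := hP.monotoneOn_temperature ha hb hT hs hu hsu.le
  have := mul_le_mul_of_nonneg_left hl (sub_nonneg.2 hmono)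
  rw [hα'] at *
  linarith

/-! ### The case `b = 0` -/

/-- Without cooling, an optimal policy is constant, and the temperature grows linearly. -/
theorem IsOptimal.exists_temperature_eq_linear (hD : 0 < D) (ha : 0 ≤ a)
    (hP : IsOptimal a 0 Te Tc E D P) (hT : IsTemperature a 0 Te D P T) :
    ∃ c, 0 ≤ c ∧ ∀ t ∈ Icc 0 D, T t = Te + c * t := by
  have hI := hP.feasible.integrable
  have h0 : (0 : ℝ) ∈ Icc 0 D := ⟨le_rfl, hD.le⟩
  have hDD : D ∈ Icc 0 D := ⟨hD.le, le_rfl⟩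
  set q := (∫ τ in (0 : ℝ)..D, P τ) / (D - 0)
  have hq : q * (D - 0) = ∫ τ in (0 : ℝ)..D, P τ := average_mul_sub hD P
  have hq0 : 0 ≤ q := div_nonneg
    (intervalIntegral.integral_nonneg hD.le hP.feasible.nonneg) (by linarith)
  have hM := hP.feasible.temperature_le D hDD
  simp only [zero_mul, Real.exp_zero, mul_one, intervalIntegral.integral_const_mul, ← hq] at hM
  -- Without cooling, heat accumulates monotonically, so the temperature constraint at `D` implies
  -- all the others.
  have hQ := hP.feasible.replaceConst le_rfl hD le_rfl hq (fun t ht => by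
    simp only [zero_mul, Real.exp_zero, mul_one, intervalIntegral.integral_same, zero_add,
      intervalIntegral.integral_const, smul_eq_mul]
    have := mul_le_mul_of_nonneg_left ht.2 (mul_nonneg ha hq0)
    linarith) (Or.inl rfl)
  have hae := hP.ae_eq_of_isFeasible_replaceConst le_rfl hD le_rfl hq hQ
  refine ⟨a * q, mul_nonneg ha hq0, fun t ht => ?_⟩
  have h := hT.sub_eq hI h0 ht
  have : ∫ τ in (0 : ℝ)..t, P τ = ∫ τ in (0 : ℝ)..t, q := by
    refine intervalIntegral.integral_congr_ae ?_
    filter_upwards [(ae_restrict_iff' measurableSet_Ioc).1 hae] with τ h1 h2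
    rw [uIoc_of_le ht.1] at h2
    exact h1 ⟨h2.1, h2.2.trans ht.2⟩
  rw [this, hT.init, intervalIntegral.integral_const, smul_eq_mul] at h
  linarith

end HeatedTransmitter

theorem lemma16 (a b Te Tc E D : ℝ) (ha : 0 ≤ a) (hb : 0 ≤ b) (hTc : Te < Tc) (hE : 0 ≤ E)
    (hD : 0 < D) (P T : ℝ → ℝ) (hP : HeatedTransmitter.IsOptimal a b Te Tc E D P)
    (hT : HeatedTransmitter.IsTemperature a b Te D P T) :
    MonotoneOn T (Set.Icc 0 D) ∧ ConcaveOn ℝ (Set.Icc 0 D) T := by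
  rcases hb.eq_or_lt with rfl | hb
  · obtain ⟨c, hc, hlin⟩ := hP.exists_temperature_eq_linear hD ha hT
    constructor
    · intro s hs t ht hst
      rw [hlin s hs, hlin t ht]
      have := mul_le_mul_of_nonneg_left hst hc
      linarith
    · refine ⟨convex_Icc _ _, fun s hs t ht α β hα hβ hαβ => ?_⟩
      rw [hlin s hs, hlin t ht, hlin _ (convex_Icc _ _ hs ht hα hβ hαβ)]
      simp only [smul_eq_mul]
      have : (α + β) * Te = Te := by rw [hαβ, one_mul]
      linarith
  · exact ⟨hP.monotoneOn_temperature ha hb hT, hP.concaveOn_temperature ha hb hT⟩
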